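/- Let $G=(V,E)$ be a finite simple graph with $n$ vertices and maximum degree $\Delta$, and let each vertex $u$ have a palette $\Psi(u)\subset\mathbb N$ of exactly $\Delta+1$ colors; initially all vertices are uncolored. The local sparsity of a vertex $v$ is $\zeta_v=\frac1\Delta\left(\binom{\Delta}{2}-m(N(v))\right)$, where $m(N(v))$ is the number of edges of the subgraph of $G$ induced by the neighborhood $N(v)$ (and $\zeta_v=0$ if $\Delta=0$). SlackGeneration is the following random process. Each vertex joins a set $S$ independently with probability $1/20$, and each vertex $u\in S$ picks a color $c_u\in\Psi(u)$ uniformly at random, all choices being independent. A vertex $u\in S$ is permanently colored with $c_u$ if no neighbor $w\in S$ of $u$ has $c_w=c_u$; all other vertices remain uncolored. Then every vertex removes the permanent colors of its neighbors from its palette. The slack of $v$ is the size of its resulting palette minus the number of its uncolored neighbors in $G$. There is an absolute constant $c_1>0$ such that for every $k\ge 1$ there is a constant $c=c(k)>0$ such that, for every such $G$ and $\Psi$ and every vertex $v$ with $\zeta_v\ge c\log n$, after SlackGeneration the slack of $v$ is at least $c_1\zeta_v$ with probability at least $1-n^{-k}$. -/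

import Mathlib

open MeasureTheory ProbabilityTheory

namespace SlackGen

/-- `m(X)`: the number of edges of the subgraph `G[X]` induced by `X`. -/
noncomputable def inducedEdgeCount {V : Type*} (G : SimpleGraph V) (X : Set V) : ℕ :=
  (G.induce X).edgeSet.ncard

/-- The local sparsity `ζ_v = (1/Δ) * (Δ.choose 2 - m(N(v)))`, where `Δ` is the maximum degree. -/
noncomputable def localSparsity {V : Type*} [Fintype V] (G : SimpleGraph V) [DecidableRel G.Adj]
    (v : V) : ℝ :=
  (1 / (G.maxDegree : ℝ)) *
    ((G.maxDegree.choose 2 : ℝ) - (inducedEdgeCount G (G.neighborSet v) : ℝ))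

/-- One round of `TryColor`, executed simultaneously by all vertices of `G[S]`, where `v ∈ S` tries
the color `col v`: it is permanently colored `col v` iff none of its neighbors in `G[S]` tries the
same color. The result is the partial coloring (`none` means uncolored); vertices outside `S` do
not take part, and `col` is ignored there. -/
def tryColor {V : Type*} [Fintype V] (G : SimpleGraph V) [DecidableRel G.Adj]
    (S : V → Bool) (col : V → ℕ) (v : V) : Option ℕ :=
  if S v = true ∧ ∀ u, G.Adj v u → S u = true → col u ≠ col v then some (col v) else none

/-- The palette of `v` after the colors permanently taken by its neighbors have been removed. -/
def updatedPalette {V : Type*} [Fintype V] (G : SimpleGraph V) [DecidableRel G.Adj]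
    (Ψ : V → Finset ℕ) (φ : V → Option ℕ) (v : V) : Finset ℕ :=
  (Ψ v).filter fun a => ∀ u, G.Adj v u → φ u ≠ some a

/-- The number of neighbors of `v` that are uncolored under `φ`. -/
def uncoloredDegree {V : Type*} [Fintype V] (G : SimpleGraph V) [DecidableRel G.Adj]
    (φ : V → Option ℕ) (v : V) : ℕ :=
  ((G.neighborFinset v).filter fun u => φ u = none).card

/-- The slack of `v` under the partial coloring `φ`, for initial palettes `Ψ`: the size of the
current palette minus the number of uncolored neighbors. -/
def slack {V : Type*} [Fintype V] (G : SimpleGraph V) [DecidableRel G.Adj]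
    (Ψ : V → Finset ℕ) (φ : V → Option ℕ) (v : V) : ℤ :=
  ((updatedPalette G Ψ φ v).card : ℤ) - (uncoloredDegree G φ v : ℤ)

/-- The sampling probability `1/20`. -/
noncomputable def sampleProb : unitInterval := ⟨1 / 20, by norm_num, by norm_num⟩

/-- The law of the random bits of `SlackGeneration`: independently over all vertices `v`, a coin
that is `true` (`v` joins the sample) with probability `1/20`, and, independently of it, a uniformly
random color from the palette `Ψ v`. -/
noncomputable def randomBits {V : Type*} [Fintype V] (Ψ : V → Finset ℕ) :
    Measure (V → Bool × ℕ) :=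
  Measure.pi fun v =>
    (bernoulliMeasure true false sampleProb).prod (uniformOn (Ψ v : Set ℕ))

/-- The partial coloring computed by `SlackGeneration` from the random bits `ω`: one
`RandomColorTrial` in the subgraph induced by the sampled vertices. -/
def slackGeneration {V : Type*} [Fintype V] (G : SimpleGraph V) [DecidableRel G.Adj]
    (ω : V → Bool × ℕ) : V → Option ℕ :=
  tryColor G (fun v => (ω v).1) (fun v => (ω v).2)

end SlackGen

/-!
A vertex `v` of degree `d` has slack `Δ + 1 - d` before anything is colored, and each color class
among its neighbors only adds to it: a permanent color of `j ≥ 1` neighbors lowers the number of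
uncolored neighbors by `j` and the size of the palette by one, or by zero if the color is not in
`Ψ v`. So a color gives an extra unit of slack as soon as it is permanent on a *witness*: two
nonadjacent neighbors of `v` if the color lies in `Ψ v`, a single neighbor otherwise
(`card_sub_degree_add_card_le_slack`). Witnesses are independent sets, so a witness all of whose
members try `c` is colored `c` unless one of its at most `2Δ` neighbors tries `c` too. Hence the
gain in slack is at least `H - B`, where `H` is the number of colors tried by some witness and `B`
is the number of colors tried by some witness and one of its neighbors
(`card_add_le_slack_add_card`).

Let `μ` be the expected number of pairs of a color and a witness trying it. As a vertex tries a
given color with probability at most `1 / (20 (Δ + 1))`, the mean of `H` is at least `19μ/20` and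
that of `B` is at most `μ/10`. Both numbers count bins of a balls-into-bins process (balls are the
vertices, bins the colors) whose set of balls has an increasing property. Such bins are negatively
associated (`lmarginal_prod_le_prod_bernoulliExp`), so that Chernoff bounds hold as for independent
events (`measureReal_mul_card_ge_le`), and `H - B ≥ μ/4` fails with probability at most
`2 exp (-μ/20)`.

Finally, any two neighbors `a`, `b` of `v` satisfy
`|Ψ a ∩ Ψ b ∩ Ψ v| + |Ψ a \ Ψ v| + |Ψ b \ Ψ v| ≥ Δ + 1`, all palettes having `Δ + 1` colors. Summed
over the `M` nonadjacent pairs of neighbors, this gives `μ ≥ M / (400 (Δ + 1))`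
(`le_sum_slackWitnesses`). Since `Δ ζ ≤ Δ (Δ - d) + M`, either the initial slack or `μ` is at
least a constant times `ζ`.
-/

namespace SlackGen

/-! ### Random subsets with independent elements -/

section Bernoulli

variable {V : Type*} [DecidableEq V]

/-- The expectation of `f T`, where `T` is a random subset of `s` that contains each `x ∈ s`
independently with probability `p x`. -/
noncomputable def bernoulliExp (p : V → ℝ) (s : Finset V) (f : Finset V → ℝ) : ℝ :=
  ∑ T ∈ s.powerset, (∏ x ∈ T, p x) * (∏ x ∈ s \ T, (1 - p x)) * f T

lemma bernoulliExp_insert (p : V → ℝ) {s : Finset V} {y : V} (hy : y ∉ s) (f : Finset V → ℝ) :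
    bernoulliExp p (insert y s) f =
      bernoulliExp p s fun T => p y * f (insert y T) + (1 - p y) * f T := by
  unfold bernoulliExp
  rw [Finset.sum_powerset_insert hy, ← Finset.sum_add_distrib]
  refine Finset.sum_congr rfl fun T hT => ?_
  have hyT : y ∉ T := fun h => hy (Finset.mem_powerset.1 hT h)
  rw [Finset.insert_sdiff_insert, Finset.insert_sdiff_of_notMem _ hyT,
    Finset.prod_insert hyT, Finset.prod_insert (by simp [hy]),
    Finset.sdiff_insert_of_notMem hy]
  ring

lemma bernoulliExp_mono {p : V → ℝ} (hp : ∀ x, 0 ≤ p x) (hp1 : ∀ x, p x ≤ 1) (s : Finset V)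
    {f g : Finset V → ℝ} (h : ∀ T, f T ≤ g T) : bernoulliExp p s f ≤ bernoulliExp p s g :=
  Finset.sum_le_sum fun T _ => mul_le_mul_of_nonneg_left (h T) <|
    mul_nonneg (Finset.prod_nonneg fun x _ => hp x)
      (Finset.prod_nonneg fun x _ => sub_nonneg.2 (hp1 x))

lemma bernoulliExp_sum {κ : Type*} (p : V → ℝ) (s : Finset V) (I : Finset κ)
    (f : κ → Finset V → ℝ) :
    bernoulliExp p s (fun T => ∑ i ∈ I, f i T) = ∑ i ∈ I, bernoulliExp p s (f i) := by
  unfold bernoulliExp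
  rw [Finset.sum_comm]
  exact Finset.sum_congr rfl fun T _ => Finset.mul_sum _ _ _

lemma bernoulliExp_sub (p : V → ℝ) (s : Finset V) (f g : Finset V → ℝ) :
    bernoulliExp p s (fun T => f T - g T) = bernoulliExp p s f - bernoulliExp p s g := by
  simp only [bernoulliExp, mul_sub, Finset.sum_sub_distrib]

lemma bernoulliExp_subset (p : V → ℝ) {s A : Finset V} (hA : A ⊆ s) :
    bernoulliExp p s (fun T => if A ⊆ T then 1 else 0) = ∏ x ∈ A, p x := by
  have key : ∏ x ∈ s, (p x + (1 - p x) * (if x ∈ A then 0 else 1)) = ∏ x ∈ A, p x := by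
    rw [← Finset.prod_subset hA (f := fun x => p x + (1 - p x) * (if x ∈ A then 0 else 1))]
    · exact Finset.prod_congr rfl fun x hx => by simp [hx]
    · intro x _ hx; simp [hx]
  rw [← key, Finset.prod_add]
  refine Finset.sum_congr rfl fun T hT => ?_
  rw [Finset.prod_mul_distrib, mul_assoc]
  congr 2
  dsimp only
  split_ifs with h
  · exact (Finset.prod_eq_one fun x hx => by
      rw [if_neg fun hxA => (Finset.mem_sdiff.1 hx).2 (h hxA)]).symm
  · obtain ⟨x, hxA, hxT⟩ := Finset.not_subset.1 h
    exact (Finset.prod_eq_zero (Finset.mem_sdiff.2 ⟨hA hxA, hxT⟩) (by simp [hxA])).symm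

lemma bernoulliExp_one_add_mul (p : V → ℝ) (s : Finset V) (a : ℝ) (f : Finset V → ℝ) :
    bernoulliExp p s (fun T => 1 + a * f T) = 1 + a * bernoulliExp p s f := by
  have h1 : bernoulliExp p s (fun T => if (∅ : Finset V) ⊆ T then 1 else 0) = 1 := by
    simpa using bernoulliExp_subset p (Finset.empty_subset s)
  simp only [bernoulliExp, Finset.empty_subset, if_true] at h1
  simp only [bernoulliExp, mul_add, Finset.sum_add_distrib, h1, Finset.mul_sum]
  congr 1
  exact Finset.sum_congr rfl fun T _ => by ring

open Classical in
/-- The random set is likely to contain a member of the family `𝒜`: the events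
`T ∩ N = A`, `A ∈ 𝒜`, are disjoint, and each has probability at least `(1 - ε) ∏ x ∈ A, p x`. -/
lemma le_bernoulliExp_exists_subset [Fintype V] {p : V → ℝ} (hp : ∀ x, 0 ≤ p x)
    (hp1 : ∀ x, p x ≤ 1) {N : Finset V} {𝒜 : Finset (Finset V)} (h𝒜 : ∀ A ∈ 𝒜, A ⊆ N) {ε : ℝ}
    (hε : ∑ x ∈ N, p x ≤ ε) :
    (1 - ε) * ∑ A ∈ 𝒜, ∏ x ∈ A, p x ≤
      bernoulliExp p Finset.univ fun T => if ∃ A ∈ 𝒜, A ⊆ T then 1 else 0 := by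
  -- the pointwise bound replaces the indicator of `T ∩ N = A` by `1 - |(T ∩ N) \ A|`
  have hpt : ∀ T : Finset V, (∑ A ∈ 𝒜, ((if A ⊆ T then (1 : ℝ) else 0) -
      ∑ x ∈ N \ A, if insert x A ⊆ T then (1 : ℝ) else 0)) ≤
        if ∃ A ∈ 𝒜, A ⊆ T then 1 else 0 := by
    intro T
    have hterm : ∀ A ∈ 𝒜, ((if A ⊆ T then (1 : ℝ) else 0) -
        ∑ x ∈ N \ A, if insert x A ⊆ T then (1 : ℝ) else 0) ≤ if A = T ∩ N then 1 else 0 := by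
      intro A hA
      have hs : ∀ x ∈ N \ A, (0 : ℝ) ≤ if insert x A ⊆ T then (1 : ℝ) else 0 := fun x _ => by
        split_ifs <;> norm_num
      by_cases hAT : A ⊆ T
      · by_cases hAN : A = T ∩ N
        · rw [if_pos hAT, if_pos hAN]
          linarith [Finset.sum_nonneg hs]
        · obtain ⟨x, hx, hxA⟩ : ∃ x ∈ T ∩ N, x ∉ A := by
            by_contra! hcon
            exact hAN ((Finset.subset_inter hAT (h𝒜 A hA)).antisymm hcon)
          rw [Finset.mem_inter] at hx
          have := Finset.single_le_sum hs (Finset.mem_sdiff.2 ⟨hx.2, hxA⟩)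
          rw [if_pos (Finset.insert_subset hx.1 hAT)] at this
          rw [if_pos hAT, if_neg hAN]
          linarith
      · rw [if_neg hAT]
        have := Finset.sum_nonneg hs
        split_ifs <;> linarith
    refine (Finset.sum_le_sum hterm).trans ?_
    rw [Finset.sum_ite_eq' 𝒜 (T ∩ N) fun _ => (1 : ℝ)]
    by_cases h : T ∩ N ∈ 𝒜
    · rw [if_pos h, if_pos ⟨_, h, Finset.inter_subset_left⟩]
    · rw [if_neg h]; split_ifs <;> norm_num
  refine le_trans ?_ (bernoulliExp_mono hp hp1 _ hpt)
  rw [bernoulliExp_sum, Finset.mul_sum]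
  refine Finset.sum_le_sum fun A _ => ?_
  rw [bernoulliExp_sub, bernoulliExp_sum, bernoulliExp_subset p (Finset.subset_univ _)]
  have hA0 : 0 ≤ ∏ x ∈ A, p x := Finset.prod_nonneg fun x _ => hp x
  have : ∑ x ∈ N \ A, bernoulliExp p Finset.univ
      (fun T => if insert x A ⊆ T then (1 : ℝ) else 0) ≤ ε * ∏ x ∈ A, p x := by
    rw [Finset.sum_congr rfl fun x hx => by
      rw [bernoulliExp_subset p (Finset.subset_univ _),
        Finset.prod_insert (Finset.mem_sdiff.1 hx).2], ← Finset.sum_mul]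
    refine mul_le_mul_of_nonneg_right (le_trans ?_ hε) hA0
    exact Finset.sum_le_sum_of_subset_of_nonneg Finset.sdiff_subset fun x _ _ => hp x
  linarith

open Classical in
/-- A union bound: given that the random set contains `A`, it meets `R A`, which is disjoint from
`A`, with probability at most `δ`. -/
lemma bernoulliExp_exists_subset_le [Fintype V] {p : V → ℝ} (hp : ∀ x, 0 ≤ p x)
    (hp1 : ∀ x, p x ≤ 1) {𝒜 : Finset (Finset V)} {R : Finset V → Finset V}
    (hR : ∀ A ∈ 𝒜, Disjoint (R A) A) {δ : ℝ} (hδ : ∀ A ∈ 𝒜, ∑ x ∈ R A, p x ≤ δ) :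
    (bernoulliExp p Finset.univ fun T => if ∃ A ∈ 𝒜, A ⊆ T ∧ ∃ x ∈ R A, x ∈ T then 1 else 0) ≤
      δ * ∑ A ∈ 𝒜, ∏ x ∈ A, p x := by
  have hpt : ∀ T : Finset V, (if ∃ A ∈ 𝒜, A ⊆ T ∧ ∃ x ∈ R A, x ∈ T then (1 : ℝ) else 0) ≤
      ∑ A ∈ 𝒜, ∑ x ∈ R A, if insert x A ⊆ T then (1 : ℝ) else 0 := by
    intro T
    have h0 : ∀ A, ∀ x ∈ R A, (0 : ℝ) ≤ if insert x A ⊆ T then (1 : ℝ) else 0 :=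
      fun A x _ => by split_ifs <;> norm_num
    split_ifs with h
    · obtain ⟨A, hA, hAT, x, hx, hxT⟩ := h
      have h1 := Finset.single_le_sum (h0 A) hx
      have h2 := Finset.single_le_sum (fun A _ => Finset.sum_nonneg (h0 A)) hA
      rw [if_pos (Finset.insert_subset hxT hAT)] at h1
      exact h1.trans h2
    · exact Finset.sum_nonneg fun A _ => Finset.sum_nonneg (h0 A)
  refine (bernoulliExp_mono hp hp1 _ hpt).trans ?_
  rw [bernoulliExp_sum, Finset.mul_sum]
  refine Finset.sum_le_sum fun A hA => ?_
  rw [bernoulliExp_sum, Finset.sum_congr rfl fun x hx => by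
      rw [bernoulliExp_subset p (Finset.subset_univ _),
        Finset.prod_insert (Finset.disjoint_left.1 (hR A hA) hx)], ← Finset.sum_mul]
  exact mul_le_mul_of_nonneg_right (hδ A hA) (Finset.prod_nonneg fun x _ => hp x)

end Bernoulli

/-! ### Negative association and Chernoff bounds for balls into bins -/

section NegativeAssociation

/-- A Weierstrass-type product inequality: if the `e i` all have the same sign, the first-order
part of the expansion of `∏ i, (a i + e i)` is a lower bound for it. -/
lemma prod_add_sum_mul_prod_erase_le {ι : Type*} [DecidableEq ι] (C : Finset ι) (a e : ι → ℝ)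
    (ha : ∀ i, 0 ≤ a i) (hae : ∀ i, 0 ≤ a i + e i)
    (he : (∀ i, 0 ≤ e i) ∨ (∀ i, e i ≤ 0)) :
    ∏ i ∈ C, a i + ∑ i ∈ C, e i * ∏ j ∈ C.erase i, a j ≤ ∏ i ∈ C, (a i + e i) := by
  induction C using Finset.induction_on with
  | empty => simp
  | insert i C hi ih =>
    rw [Finset.prod_insert hi, Finset.sum_insert hi, Finset.erase_insert hi, Finset.prod_insert hi]
    have h1 : ∑ j ∈ C, e j * ∏ k ∈ (insert i C).erase j, a k =
        a i * ∑ j ∈ C, e j * ∏ k ∈ C.erase j, a k := by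
      rw [Finset.mul_sum]
      refine Finset.sum_congr rfl fun j hj => ?_
      have hij : i ≠ j := fun h => hi (h ▸ hj)
      rw [Finset.erase_insert_of_ne hij, Finset.prod_insert (by simp [hi])]
      ring
    have h2 : e i * ∏ j ∈ C, a j ≤ e i * ∏ j ∈ C, (a j + e j) := by
      rcases he with he | he
      · exact mul_le_mul_of_nonneg_left
          (Finset.prod_le_prod (fun j _ => ha j) fun j _ => by linarith [he j]) (he i)
      · exact mul_le_mul_of_nonpos_left
          (Finset.prod_le_prod (fun j _ => hae j) fun j _ => by linarith [he j]) (he i)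
    rw [h1]
    nlinarith [mul_le_mul_of_nonneg_left ih (ha i)]

variable {V ι α : Type*} [DecidableEq V] [MeasurableSpace α] [MeasurableSingletonClass α]

/-- A single ball that falls into at most one of the bins `c ∈ C` (bin `c` is hit by the outcome
`e c`) may be replaced by independent indicators, one for each bin. -/
lemma lintegral_prod_ite_le [Countable α] [DecidableEq α] (ν : Measure α) [IsProbabilityMeasure ν]
    {e : ι → α} (he : Function.Injective e) (C : Finset ι) (a b : ι → ℝ) (ha : ∀ c, 0 ≤ a c)
    (hb : ∀ c, 0 ≤ b c) (hab : (∀ c, a c ≤ b c) ∨ (∀ c, b c ≤ a c)) :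
    ∫⁻ z, ENNReal.ofReal (∏ c ∈ C, if z = e c then b c else a c) ∂ν ≤
      ENNReal.ofReal (∏ c ∈ C, (ν.real {e c} * b c + (1 - ν.real {e c}) * a c)) := by
  classical
  set K : ℝ := ∏ c ∈ C, a c with hK
  set D : ι → ℝ := fun c => (b c - a c) * ∏ j ∈ C.erase c, a j with hD
  -- since at most one bin is hit, the integrand is affine in the indicators of the bins
  have hfun : (fun z => ∏ c ∈ C, if z = e c then b c else a c) =
      fun z => K + ∑ c ∈ C, ({e c} : Set α).indicator (fun _ => D c) z := by
    funext z
    by_cases hz : ∃ c ∈ C, z = e c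
    · obtain ⟨c, hc, rfl⟩ := hz
      have h1 : ∑ j ∈ C, ({e j} : Set α).indicator (fun _ => D j) (e c) = D c := by
        rw [Finset.sum_eq_single_of_mem c hc fun j _ hj => by simp [he.eq_iff, hj.symm]]
        simp
      rw [h1, hK, ← Finset.mul_prod_erase C a hc, ← Finset.mul_prod_erase C _ hc, if_pos rfl,
        Finset.prod_congr rfl fun j hj => by
          rw [if_neg fun h => (Finset.mem_erase.1 hj).1 (he h).symm]]
      ring
    · push Not at hz
      rw [Finset.prod_congr rfl fun j hj => by rw [if_neg (hz j hj)],
        Finset.sum_eq_zero fun j hj => by simp [hz j hj], add_zero]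
  have hint : ∀ c ∈ C, Integrable (({e c} : Set α).indicator fun _ => D c) ν := fun c _ =>
    (integrable_const _).indicator (measurableSet_singleton _)
  have hI : ∫ z, (∏ c ∈ C, if z = e c then b c else a c) ∂ν = K + ∑ c ∈ C, ν.real {e c} * D c := by
    rw [hfun, integral_add (integrable_const _) (integrable_finsetSum _ hint),
      integral_finsetSum _ hint]
    simp only [integral_const, probReal_univ, one_mul,
      integral_indicator_const _ (measurableSet_singleton _), smul_eq_mul]
  rw [← ofReal_integral_eq_lintegral_ofReal, hI]
  · refine ENNReal.ofReal_le_ofReal ?_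
    have hq : ∀ c, 0 ≤ ν.real {e c} ∧ ν.real {e c} ≤ 1 := fun c =>
      ⟨measureReal_nonneg, measureReal_le_one⟩
    have := prod_add_sum_mul_prod_erase_le C a (fun c => ν.real {e c} * (b c - a c)) ha
      (fun c => by
        have h1 := mul_nonneg (hq c).1 (hb c)
        have h2 := mul_nonneg (sub_nonneg.2 (hq c).2) (ha c)
        linarith)
      (hab.imp (fun h c => mul_nonneg (hq c).1 (sub_nonneg.2 (h c)))
        fun h c => mul_nonpos_of_nonneg_of_nonpos (hq c).1 (sub_nonpos.2 (h c)))
    calc _ = K + ∑ c ∈ C, ν.real {e c} * (b c - a c) * ∏ j ∈ C.erase c, a j := by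
          simp only [hD, mul_assoc]
      _ ≤ _ := this
      _ = _ := Finset.prod_congr rfl fun c _ => by ring
  · rw [hfun]
    exact (integrable_const _).add (integrable_finsetSum _ hint)
  · exact Filter.Eventually.of_forall fun z => Finset.prod_nonneg fun c _ => by
      split_ifs <;> simp [ha, hb]

variable [Fintype V] [Countable α] [DecidableEq α]

/-- Negative association of the bins in a balls-into-bins process: for monotone functions, all in
the same direction, of the sets of balls in the bins, the expectation of the product is at most
the product of the expectations. The balls are replaced by independent indicators one at a time. -/
lemma lmarginal_prod_le_prod_bernoulliExp (μ : V → Measure α) [∀ x, IsProbabilityMeasure (μ x)]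
    {e : ι → α} (he : Function.Injective e) (C : Finset ι) (s : Finset V) :
    ∀ (g : ι → Finset V → ℝ), (∀ c T, 0 ≤ g c T) →
      ((∀ c, Monotone (g c)) ∨ (∀ c, Antitone (g c))) → ∀ ω₀ : V → α,
      (∫⋯∫⁻_s, (fun ω => ENNReal.ofReal (∏ c ∈ C, g c {x ∈ s | ω x = e c})) ∂μ) ω₀ ≤
        ENNReal.ofReal (∏ c ∈ C, bernoulliExp (fun x => (μ x).real {e c}) s (g c)) := by
  induction s using Finset.induction_on with
  | empty => intro g _ _ ω₀; simp [bernoulliExp]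
  | insert y s hy ih =>
    intro g h0 hmono ω₀
    rw [lmarginal_insert' _ (measurable_of_countable _) hy]
    -- averaging over the ball `y` alone turns `g` into a family `g'` with the same properties
    set g' : ι → Finset V → ℝ := fun c T =>
      (μ y).real {e c} * g c (insert y T) + (1 - (μ y).real {e c}) * g c T with hg'
    have hq : ∀ c, 0 ≤ (μ y).real {e c} ∧ 0 ≤ 1 - (μ y).real {e c} := fun c =>
      ⟨measureReal_nonneg, sub_nonneg.2 measureReal_le_one⟩
    have hstep : ∀ ω : V → α, ∫⁻ z, ENNReal.ofReal
        (∏ c ∈ C, g c {x ∈ insert y s | Function.update ω y z x = e c}) ∂μ y ≤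
        ENNReal.ofReal (∏ c ∈ C, g' c {x ∈ s | ω x = e c}) := by
      intro ω
      have hset : ∀ z c, g c {x ∈ insert y s | Function.update ω y z x = e c} =
          if z = e c then g c (insert y {x ∈ s | ω x = e c}) else g c {x ∈ s | ω x = e c} := by
        intro z c
        have hs : {x ∈ s | Function.update ω y z x = e c} = {x ∈ s | ω x = e c} :=
          Finset.filter_congr fun x hx => by
            rw [Function.update_of_ne (ne_of_mem_of_not_mem hx hy)]
        rw [Finset.filter_insert, Function.update_self, hs]
        split_ifs <;> rfl
      simp only [hset]
      exact lintegral_prod_ite_le (μ y) he C _ _ (fun c => h0 c _) (fun c => h0 c _)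
        (hmono.imp (fun h c => h c (Finset.subset_insert _ _))
          fun h c => h c (Finset.subset_insert _ _))
    refine (lmarginal_mono hstep ω₀).trans ?_
    have hg0 : ∀ c T, 0 ≤ g' c T := fun c T =>
      add_nonneg (mul_nonneg (hq c).1 (h0 c _)) (mul_nonneg (hq c).2 (h0 c _))
    have hgm : (∀ c, Monotone (g' c)) ∨ (∀ c, Antitone (g' c)) := by
      refine hmono.imp (fun h c T T' hT => ?_) fun h c T T' hT => ?_ <;>
      exact add_le_add
        (mul_le_mul_of_nonneg_left (h c (Finset.insert_subset_insert _ hT)) (hq c).1)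
        (mul_le_mul_of_nonneg_left (h c hT) (hq c).2)
    refine (ih g' hg0 hgm ω₀).trans (le_of_eq ?_)
    congr 1
    exact Finset.prod_congr rfl fun c _ => (bernoulliExp_insert _ hy _).symm

open Classical in
/-- Exponential moments of the number of bins whose set of balls has an increasing property: they
are at most those of a Poisson variable of the same mean. -/
lemma lintegral_exp_card_le (μ : V → Measure α) [∀ x, IsProbabilityMeasure (μ x)]
    {e : ι → α} (he : Function.Injective e) (C : Finset ι) (h : ι → Finset V → Prop)
    (hh : ∀ c, Monotone (h c)) (t : ℝ) :
    ∫⁻ ω, ENNReal.ofReal (Real.exp (t * {c ∈ C | h c {x | ω x = e c}}.card)) ∂Measure.pi μ ≤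
      ENNReal.ofReal (Real.exp ((Real.exp t - 1) * ∑ c ∈ C,
        bernoulliExp (fun x => (μ x).real {e c}) Finset.univ fun T => if h c T then 1 else 0)) := by
  set g : ι → Finset V → ℝ := fun c T => Real.exp (t * if h c T then 1 else 0) with hg
  obtain ⟨ω₀⟩ : Nonempty (V → α) :=
    (Measure.pi μ).nonempty_of_neZero
  have hind : ∀ c, Monotone fun T => if h c T then (1 : ℝ) else 0 := by
    intro c T T' hT
    dsimp only
    by_cases h1 : h c T
    · rw [if_pos h1, if_pos (hh c hT h1)]
    · rw [if_neg h1]; split_ifs <;> norm_num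
  have hmono : (∀ c, Monotone (g c)) ∨ (∀ c, Antitone (g c)) := by
    rcases le_total 0 t with ht | ht
    · exact Or.inl fun c T T' hT =>
        Real.exp_le_exp.2 (mul_le_mul_of_nonneg_left (hind c hT) ht)
    · exact Or.inr fun c T T' hT =>
        Real.exp_le_exp.2 (mul_le_mul_of_nonpos_left (hind c hT) ht)
  have key := lmarginal_prod_le_prod_bernoulliExp μ he C Finset.univ g
    (fun c T => (Real.exp_pos _).le) hmono ω₀
  rw [← lintegral_eq_lmarginal_univ] at key
  calc _ = ∫⁻ ω, ENNReal.ofReal (∏ c ∈ C, g c {x | ω x = e c}) ∂Measure.pi μ := by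
        refine lintegral_congr fun ω => ?_
        rw [hg, ← Real.exp_sum, ← Finset.mul_sum, Finset.sum_boole]
    _ ≤ _ := key
    _ ≤ _ := by
        refine ENNReal.ofReal_le_ofReal ?_
        rw [Finset.mul_sum, Real.exp_sum]
        have hgeq : ∀ c, g c = fun T => 1 + (Real.exp t - 1) * if h c T then 1 else 0 := by
          intro c; funext T; simp only [hg]; split_ifs <;> simp
        refine Finset.prod_le_prod (fun c _ => ?_) fun c _ => ?_
        · exact Finset.sum_nonneg fun T _ => mul_nonneg (mul_nonneg
            (Finset.prod_nonneg fun x _ => measureReal_nonneg)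
            (Finset.prod_nonneg fun x _ => sub_nonneg.2 measureReal_le_one)) (Real.exp_pos _).le
        · rw [hgeq, bernoulliExp_one_add_mul, add_comm]
          exact Real.add_one_le_exp _

open Classical in
/-- Chernoff's bound, for both tails: the lower one for `t ≤ 0`, the upper one for `0 ≤ t`. -/
lemma measureReal_mul_card_ge_le (μ : V → Measure α) [∀ x, IsProbabilityMeasure (μ x)]
    {e : ι → α} (he : Function.Injective e) (C : Finset ι) (h : ι → Finset V → Prop)
    (hh : ∀ c, Monotone (h c)) (t b : ℝ) :
    (Measure.pi μ).real {ω | b ≤ t * {c ∈ C | h c {x | ω x = e c}}.card} ≤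
      Real.exp ((Real.exp t - 1) * (∑ c ∈ C,
        bernoulliExp (fun x => (μ x).real {e c}) Finset.univ
          fun T => if h c T then 1 else 0) - b) := by
  have h1 := mul_meas_ge_le_lintegral (μ := Measure.pi μ) (f := fun ω : V → α => ENNReal.ofReal
    (Real.exp (t * {c ∈ C | h c {x | ω x = e c}}.card))) (measurable_of_countable _)
    (ENNReal.ofReal (Real.exp b))
  have h2 := h1.trans (lintegral_exp_card_le μ he C h hh t)
  have hset : {ω : V → α | ENNReal.ofReal (Real.exp b) ≤ ENNReal.ofReal
      (Real.exp (t * {c ∈ C | h c {x | ω x = e c}}.card))} =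
      {ω | b ≤ t * {c ∈ C | h c {x | ω x = e c}}.card} := by
    ext ω
    simp only [Set.mem_ofPred_eq]
    rw [ENNReal.ofReal_le_ofReal_iff (Real.exp_pos _).le, Real.exp_le_exp]
  rw [hset] at h2
  have h3 := ENNReal.toReal_mono ENNReal.ofReal_ne_top h2
  rw [ENNReal.toReal_mul, ENNReal.toReal_ofReal (Real.exp_pos _).le,
    ENNReal.toReal_ofReal (Real.exp_pos _).le] at h3
  rw [Real.exp_sub, le_div_iff₀ (Real.exp_pos _), mul_comm]
  exact h3

end NegativeAssociation

/-! ### Witnesses of slack -/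

section Witness

variable {V : Type*} [Fintype V] (G : SimpleGraph V) [DecidableRel G.Adj] (Ψ : V → Finset ℕ)

open Classical in
/-- The pairs of distinct nonadjacent neighbors of `v`. -/
noncomputable def nonadjPairs (v : V) : Finset (Finset V) :=
  {A ∈ (G.neighborFinset v).powersetCard 2 | G.IsIndepSet A}

open Classical in
/-- The sets of neighbors of `v` whose being colored `c` gives `v` a unit of slack: nonadjacent
pairs if `c` is in the palette of `v`, and single vertices otherwise. -/
noncomputable def slackWitnesses (v : V) (c : ℕ) : Finset (Finset V) :=
  if c ∈ Ψ v then nonadjPairs G v else (G.neighborFinset v).powersetCard 1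

/-- The vertices that are sampled and try the color `c`. -/
def triers {V : Type*} [Fintype V] (ω : V → Bool × ℕ) (c : ℕ) : Finset V :=
  {x | ω x = (true, c)}

/-- Some witness for the color `c` lies in the set `T` of vertices. -/
def ContainsWitness (v : V) (c : ℕ) (T : Finset V) : Prop :=
  ∃ A ∈ slackWitnesses G Ψ v c, A ⊆ T

/-- Some witness for the color `c` lies in the set `T` of vertices, and so does a neighbor of one
of its members. -/
def ContainsSpoiledWitness (v : V) (c : ℕ) (T : Finset V) : Prop :=
  ∃ A ∈ slackWitnesses G Ψ v c, A ⊆ T ∧ ∃ u ∈ A, ∃ x ∈ T, G.Adj u x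

variable {G Ψ}

lemma mem_nonadjPairs {v : V} {A : Finset V} :
    A ∈ nonadjPairs G v ↔ (A ⊆ G.neighborFinset v ∧ A.card = 2) ∧ G.IsIndepSet A := by
  simp only [nonadjPairs, Finset.mem_filter, Finset.mem_powersetCard]

lemma slackWitnesses_spec {v : V} {c : ℕ} {A : Finset V} (hA : A ∈ slackWitnesses G Ψ v c) :
    A ⊆ G.neighborFinset v ∧ A.card = (if c ∈ Ψ v then 2 else 1) ∧ G.IsIndepSet A := by
  unfold slackWitnesses at hA
  split_ifs at hA ⊢ with hc
  · exact ⟨(mem_nonadjPairs.1 hA).1.1, (mem_nonadjPairs.1 hA).1.2, (mem_nonadjPairs.1 hA).2⟩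
  · obtain ⟨h1, h2⟩ := Finset.mem_powersetCard.1 hA
    obtain ⟨x, rfl⟩ := Finset.card_eq_one.1 h2
    exact ⟨h1, h2, by simp⟩

open Classical in
/-- Each color of `D`, the color of two neighbors of `v` or the color of one neighbor and not in
the palette of `v`, adds a unit to the slack present before any vertex is colored. -/
lemma card_sub_degree_add_card_le_slack (φ : V → Option ℕ) (v : V) (D : Finset ℕ)
    (hD : ∀ c ∈ D, (if c ∈ Ψ v then 2 else 1) ≤ {u ∈ G.neighborFinset v | φ u = some c}.card) :
    ((Ψ v).card : ℤ) - G.degree v + D.card ≤ slack G Ψ φ v := by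
  set N := G.neighborFinset v with hN
  set K := {u ∈ N | ¬ φ u = none} with hK
  set R := {c ∈ Ψ v | ¬ ∀ u, G.Adj v u → φ u ≠ some c} with hR
  have h1 : (updatedPalette G Ψ φ v).card + R.card = (Ψ v).card := by
    unfold updatedPalette
    convert Finset.card_filter_add_card_filter_not (s := Ψ v) _
  have h2 : uncoloredDegree G φ v + K.card = G.degree v := by
    rw [← G.card_neighborFinset_eq_degree v]
    unfold uncoloredDegree
    convert Finset.card_filter_add_card_filter_not (s := N) _
  have h3 : R.card + D.card ≤ K.card := by
    -- the colors in use, counted with multiplicity in `K` and once in each of `R` and `D`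
    set I := K.image fun u => (φ u).getD 0 with hI
    have hfib : ∀ c ∈ I, {u ∈ N | φ u = some c} ⊆ {u ∈ K | (φ u).getD 0 = c} := by
      intro c _ u hu
      simp only [Finset.mem_filter, hK] at hu ⊢
      simp [hu.1, hu.2]
    have hIpos : ∀ c, 0 < {u ∈ N | φ u = some c}.card → c ∈ I := by
      intro c hc
      obtain ⟨u, hu⟩ := Finset.card_pos.1 hc
      rw [Finset.mem_filter] at hu
      exact Finset.mem_image.2 ⟨u, Finset.mem_filter.2 ⟨hu.1, by simp [hu.2]⟩, by simp [hu.2]⟩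
    have hRpos : ∀ c ∈ R, 0 < {u ∈ N | φ u = some c}.card := by
      intro c hc
      have := (Finset.mem_filter.1 hc).2
      push Not at this
      obtain ⟨u, hvu, hu⟩ := this
      exact Finset.card_pos.2 ⟨u, Finset.mem_filter.2 ⟨by simpa [hN] using hvu, hu⟩⟩
    have hDpos : ∀ c ∈ D, 0 < {u ∈ N | φ u = some c}.card := fun c hc =>
      lt_of_lt_of_le (by split_ifs <;> norm_num) (hD c hc)
    have hRI : {c ∈ I | c ∈ R} = R := by
      ext c; simpa using fun hc => hIpos c (hRpos c hc)
    have hDI : {c ∈ I | c ∈ D} = D := by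
      ext c; simpa using fun hc => hIpos c (hDpos c hc)
    rw [Finset.card_eq_sum_card_image (fun u => (φ u).getD 0) K, ← hRI, ← hDI,
      Finset.card_filter, Finset.card_filter, ← Finset.sum_add_distrib]
    refine Finset.sum_le_sum fun c hc => ?_
    refine le_trans ?_ (Finset.card_le_card (hfib c hc))
    by_cases hcD : c ∈ D
    · have := hD c hcD
      by_cases hcR : c ∈ R
      · rw [if_pos (Finset.mem_filter.1 hcR).1] at this
        rw [if_pos hcD, if_pos hcR]
        exact this
      · rw [if_pos hcD, if_neg hcR]
        exact hDpos c hcD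
    · rw [if_neg hcD, add_zero]
      split_ifs with hcR
      · exact hRpos c hcR
      · exact Nat.zero_le _
  unfold slack
  omega

open Classical in
/-- A color gives slack once a witness tries it and no neighbor of the witness does. -/
lemma card_add_le_slack_add_card (ω : V → Bool × ℕ) (v : V) (C : Finset ℕ) :
    ((Ψ v).card : ℤ) - G.degree v + {c ∈ C | ContainsWitness G Ψ v c (triers ω c)}.card ≤
      slack G Ψ (slackGeneration G ω) v +
        {c ∈ C | ContainsSpoiledWitness G Ψ v c (triers ω c)}.card := by
  set H := {c ∈ C | ContainsWitness G Ψ v c (triers ω c)}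
  set B := {c ∈ C | ContainsSpoiledWitness G Ψ v c (triers ω c)}
  have hD : ∀ c ∈ H \ B, (if c ∈ Ψ v then 2 else 1) ≤
      {u ∈ G.neighborFinset v | slackGeneration G ω u = some c}.card := by
    intro c hc
    obtain ⟨hcH, hcB⟩ := Finset.mem_sdiff.1 hc
    obtain ⟨hcC, A, hA, hAT⟩ := Finset.mem_filter.1 hcH
    have hno : ∀ u ∈ A, ∀ x, G.Adj u x → ω x ≠ (true, c) := fun u hu x hux hx =>
      hcB <| Finset.mem_filter.2 ⟨hcC, A, hA, hAT, u, hu, x,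
        by simpa [triers] using hx, hux⟩
    obtain ⟨hAN, hcard, -⟩ := slackWitnesses_spec hA
    rw [← hcard]
    refine Finset.card_le_card fun u hu => Finset.mem_filter.2 ⟨hAN hu, ?_⟩
    have hωu : ω u = (true, c) := by simpa [triers] using hAT hu
    simp only [slackGeneration, tryColor, hωu]
    rw [if_pos ⟨trivial, fun x hux hx hc => hno u hu x hux (Prod.ext hx hc)⟩]
  have h1 := card_sub_degree_add_card_le_slack (slackGeneration G ω) v (H \ B) hD
  have h2 := Finset.le_card_sdiff B H
  omega

lemma choose_degree_le_inducedEdgeCount_add (v : V) :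
    (G.degree v).choose 2 ≤ inducedEdgeCount G (G.neighborSet v) + (nonadjPairs G v).card := by
  classical
  rw [← G.card_neighborFinset_eq_degree v, ← Finset.card_powersetCard,
    ← Finset.card_filter_add_card_filter_not (s := (G.neighborFinset v).powersetCard 2)
      (fun A : Finset V => G.IsIndepSet A), add_comm]
  refine Nat.add_le_add ?_ (le_of_eq (by unfold nonadjPairs; congr))
  have hfin : (G.induce (G.neighborSet v)).edgeSet.Finite := Set.toFinite _
  rw [inducedEdgeCount, Set.ncard_eq_toFinset_card _ hfin]
  refine Finset.card_le_card_of_surjOn (fun e => (e.map Subtype.val).toFinset) fun A hA => ?_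
  obtain ⟨hA, hdep⟩ := Finset.mem_filter.1 (Finset.mem_coe.1 hA)
  obtain ⟨hAN, hA2⟩ := Finset.mem_powersetCard.1 hA
  obtain ⟨a, b, hab, rfl⟩ := Finset.card_eq_two.1 hA2
  have hadj : G.Adj a b := by
    by_contra hcon
    refine hdep ?_
    intro x hx y hy hxy
    simp only [Finset.coe_insert, Finset.coe_singleton, Set.mem_insert_iff,
      Set.mem_singleton_iff] at hx hy
    rcases hx with rfl | rfl <;> rcases hy with rfl | rfl
    · exact absurd rfl hxy
    · exact hcon
    · exact fun h => hcon h.symm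
    · exact absurd rfl hxy
  have ha : a ∈ G.neighborSet v := by simpa using hAN (Finset.mem_insert_self a _)
  have hb : b ∈ G.neighborSet v := by
    simpa using hAN (Finset.mem_insert_of_mem (Finset.mem_singleton_self b))
  refine ⟨s(⟨a, ha⟩, ⟨b, hb⟩), by simpa using hadj, ?_⟩
  ext x
  simp

/-- The weight of the witnesses: in the sum over all colors of the expected numbers of witnesses
trying the color, each nonadjacent pair accounts for at least `q² D`, because its two palettes and
the palette of `v` all have size `D`. -/
lemma le_sum_slackWitnesses [DecidableEq V] {v : V} {C : Finset ℕ} (hC : ∀ x, Ψ x ⊆ C)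
    {D : ℕ} (hΨ : ∀ x, (Ψ x).card = D) {q : ℝ} (hq : 0 ≤ q) (hqD : q * G.degree v ≤ 1) :
    q ^ 2 * (D * (nonadjPairs G v).card) ≤
      ∑ c ∈ C, ∑ A ∈ slackWitnesses G Ψ v c, ∏ x ∈ A, if c ∈ Ψ x then q else 0 := by
  have hone : ∀ c : ℕ, ∀ x : V, (0 : ℝ) ≤ if c ∈ Ψ x then 1 else 0 := fun c x => by
    split_ifs <;> norm_num
  -- the colors in a palette number `D`
  have hsum : ∀ x, ∑ c ∈ C, (if c ∈ Ψ x then (1 : ℝ) else 0) = D := by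
    intro x
    rw [Finset.sum_boole, ← hΨ x, Finset.filter_mem_eq_inter, Finset.inter_eq_right.2 (hC x)]
  -- summing the left-hand side over `c` gives `2 D - D = D` for each pair
  have hcolor : ∀ c ∈ C, q ^ 2 * ∑ A ∈ nonadjPairs G v,
      ((∑ x ∈ A, if c ∈ Ψ x then (1 : ℝ) else 0) - if c ∈ Ψ v then 1 else 0) ≤
        ∑ A ∈ slackWitnesses G Ψ v c, ∏ x ∈ A, if c ∈ Ψ x then q else 0 := by
    intro c _
    unfold slackWitnesses
    by_cases hc : c ∈ Ψ v
    · simp only [if_pos hc]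
      rw [Finset.mul_sum]
      refine Finset.sum_le_sum fun A hA => ?_
      -- for a color of `Ψ v` the claim is `[c ∈ Ψ a] + [c ∈ Ψ b] - 1 ≤ [c ∈ Ψ a ∩ Ψ b]`
      obtain ⟨a, b, hab, rfl⟩ := Finset.card_eq_two.1 (mem_nonadjPairs.1 hA).1.2
      rw [Finset.sum_pair hab, Finset.prod_pair hab]
      split_ifs <;> nlinarith [sq_nonneg q]
    · simp only [if_neg hc, sub_zero]
      rw [Finset.powersetCard_one, Finset.sum_map]
      simp only [Function.Embedding.coeFn_mk, Finset.prod_singleton]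
      have hswap : ∑ A ∈ nonadjPairs G v, ∑ x ∈ A, (if c ∈ Ψ x then (1 : ℝ) else 0) =
          ∑ x ∈ G.neighborFinset v, ∑ A ∈ nonadjPairs G v with x ∈ A,
            if c ∈ Ψ x then (1 : ℝ) else 0 :=
        Finset.sum_comm' fun A x => by
          simp only [Finset.mem_filter]
          exact ⟨fun h => ⟨h, (mem_nonadjPairs.1 h.1).1.1 h.2⟩, fun h => h.1⟩
      rw [hswap, Finset.mul_sum]
      refine Finset.sum_le_sum fun x _ => ?_
      -- a vertex lies in at most `deg v` of the pairs
      have hcard : ({A ∈ nonadjPairs G v | x ∈ A}.card : ℝ) ≤ G.degree v := by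
        rw [← G.card_neighborFinset_eq_degree v]
        refine Nat.cast_le.2 (le_trans (Finset.card_le_card ?_)
          (Finset.card_image_le (f := fun w => ({x, w} : Finset V))))
        intro A hA
        obtain ⟨hA, hxA⟩ := Finset.mem_filter.1 hA
        obtain ⟨⟨hAN, hA2⟩, -⟩ := mem_nonadjPairs.1 hA
        obtain ⟨w, hw⟩ : ∃ w, A.erase x = {w} := Finset.card_eq_one.1 (by
          rw [Finset.card_erase_of_mem hxA, hA2])
        refine Finset.mem_image.2 ⟨w, hAN (Finset.mem_of_mem_erase (a := x) ?_), ?_⟩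
        · rw [hw]; exact Finset.mem_singleton_self w
        · rw [← Finset.insert_erase hxA, hw]
      rw [Finset.sum_const, nsmul_eq_mul]
      split_ifs
      · nlinarith [mul_le_mul_of_nonneg_left hcard (sq_nonneg q),
          mul_le_mul_of_nonneg_left hqD hq]
      · simp
  refine le_trans (le_of_eq ?_) (Finset.sum_le_sum hcolor)
  rw [← Finset.mul_sum, Finset.sum_comm]
  congr 1
  rw [mul_comm, ← nsmul_eq_mul, ← Finset.sum_const]
  refine Finset.sum_congr rfl fun A hA => ?_
  rw [Finset.sum_sub_distrib, hsum, Finset.sum_comm]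
  simp only [hsum, Finset.sum_const, (mem_nonadjPairs.1 hA).1.2]
  ring

end Witness

/-! ### The law of the random bits -/

section Law

/-- The law of the random bits of a vertex with palette `P`. -/
noncomputable def bitsLaw (P : Finset ℕ) : Measure (Bool × ℕ) :=
  (bernoulliMeasure true false sampleProb).prod (uniformOn (P : Set ℕ))

lemma isProbabilityMeasure_bitsLaw {P : Finset ℕ} (hP : P.Nonempty) :
    IsProbabilityMeasure (bitsLaw P) := by
  have := isProbabilityMeasure_uniformOn (s := (P : Set ℕ)) P.finite_toSet (by simpa using hP)
  unfold bitsLaw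
  infer_instance

lemma isProbabilityMeasure_randomBits {V : Type*} [Fintype V] {Ψ : V → Finset ℕ}
    (hΨ : ∀ u, (Ψ u).Nonempty) : IsProbabilityMeasure (randomBits Ψ) := by
  have := fun u => isProbabilityMeasure_bitsLaw (hΨ u)
  exact inferInstanceAs (IsProbabilityMeasure (Measure.pi fun u => bitsLaw (Ψ u)))

lemma bitsLaw_real_singleton (P : Finset ℕ) (c : ℕ) :
    (bitsLaw P).real {(true, c)} = if c ∈ P then 1 / (20 * (P.card : ℝ)) else 0 := by
  unfold bitsLaw
  rw [← Set.singleton_prod_singleton, measureReal_prod_prod,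
    bernoulliMeasure_real_apply_of_mem_of_notMem _ (measurableSet_singleton _) (by simp) (by simp),
    measureReal_def, ← Finset.coe_singleton c, uniformOn_apply_finset]
  split_ifs with hc
  · rw [Finset.inter_singleton_of_mem hc]
    simp [sampleProb]
    ring
  · rw [Finset.inter_singleton_of_notMem hc]
    simp

end Law

/-! ### Slack with high probability -/

section Main

variable {V : Type*} [Fintype V] {G : SimpleGraph V} [DecidableRel G.Adj] {Ψ : V → Finset ℕ}

open Classical in
/-- The expected number of colors tried by a witness is at least `19/20` of the expected number of
witnesses. -/
lemma le_sum_bernoulliExp_witness {p : ℕ → V → ℝ} {q : ℝ} (hp0 : ∀ c x, 0 ≤ p c x)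
    (hp1 : ∀ c x, p c x ≤ 1) (hpq : ∀ c x, p c x ≤ q)
    (hq : q * ((G.maxDegree : ℝ) + 1) ≤ 1 / 20) (v : V) (C : Finset ℕ) :
    19 / 20 * ∑ c ∈ C, ∑ A ∈ slackWitnesses G Ψ v c, ∏ x ∈ A, p c x ≤
      ∑ c ∈ C, bernoulliExp (p c) Finset.univ
        fun T => if ContainsWitness G Ψ v c T then 1 else 0 := by
  rw [Finset.mul_sum]
  refine Finset.sum_le_sum fun c _ => ?_
  have hd : (G.degree v : ℝ) ≤ G.maxDegree := Nat.cast_le.2 (G.degree_le_maxDegree v)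
  have hq0 : 0 ≤ q := (hp0 0 v).trans (hpq 0 v)
  have := le_bernoulliExp_exists_subset (hp0 c) (hp1 c)
    (fun A hA => (slackWitnesses_spec (G := G) (Ψ := Ψ) (v := v) (c := c) hA).1)
    (ε := 1 / 20) (by
      refine (Finset.sum_le_card_nsmul _ _ q fun x _ => hpq c x).trans ?_
      rw [nsmul_eq_mul, G.card_neighborFinset_eq_degree]
      nlinarith)
  norm_num at this ⊢
  unfold ContainsWitness
  exact this.trans_eq (by congr!)

open Classical in
/-- The expected number of colors tried by a witness together with one of its neighbors is at most
a tenth of the expected number of witnesses. -/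
lemma sum_bernoulliExp_spoiled_witness_le {p : ℕ → V → ℝ} {q : ℝ} (hp0 : ∀ c x, 0 ≤ p c x)
    (hp1 : ∀ c x, p c x ≤ 1) (hpq : ∀ c x, p c x ≤ q)
    (hq : q * ((G.maxDegree : ℝ) + 1) ≤ 1 / 20) (v : V) (C : Finset ℕ) :
    (∑ c ∈ C, bernoulliExp (p c) Finset.univ
        fun T => if ContainsSpoiledWitness G Ψ v c T then 1 else 0) ≤
      1 / 10 * ∑ c ∈ C, ∑ A ∈ slackWitnesses G Ψ v c, ∏ x ∈ A, p c x := by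
  rw [Finset.mul_sum]
  refine Finset.sum_le_sum fun c _ => ?_
  have hq0 : 0 ≤ q := (hp0 0 v).trans (hpq 0 v)
  have hiff : ∀ T, ContainsSpoiledWitness G Ψ v c T ↔ ∃ A ∈ slackWitnesses G Ψ v c, A ⊆ T ∧
      ∃ x ∈ A.biUnion (G.neighborFinset ·), x ∈ T := fun T => by
    simp only [ContainsSpoiledWitness, Finset.mem_biUnion, SimpleGraph.mem_neighborFinset]
    grind
  simp only [hiff]
  refine le_of_eq_of_le (by congr!) (bernoulliExp_exists_subset_le (hp0 c) (hp1 c)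
    (R := fun A => A.biUnion (G.neighborFinset ·)) (fun A hA => ?_) (fun A hA => ?_))
  · rw [Finset.disjoint_left]
    intro x hx hxA
    obtain ⟨u, hu, hux⟩ := Finset.mem_biUnion.1 hx
    have hux : G.Adj u x := by simpa using hux
    exact (slackWitnesses_spec hA).2.2 hu hxA hux.ne hux
  · have hA2 : A.card ≤ 2 := by rw [(slackWitnesses_spec hA).2.1]; split_ifs <;> norm_num
    have hcard : ((A.biUnion (G.neighborFinset ·)).card : ℝ) ≤ 2 * (G.maxDegree : ℝ) := by
      have h1 := Finset.card_biUnion_le_card_mul A (G.neighborFinset ·) G.maxDegree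
        fun u _ => by rw [G.card_neighborFinset_eq_degree]; exact G.degree_le_maxDegree u
      exact_mod_cast h1.trans (Nat.mul_le_mul_right _ hA2)
    refine (Finset.sum_le_card_nsmul _ _ q fun x _ => hpq c x).trans ?_
    rw [nsmul_eq_mul]
    nlinarith

/-- The slack exceeds its initial value by a quarter of the expected number `μ` of witnesses,
unless at most `μ / 2` colors are tried by a witness or at least `μ / 4` of them are tried by a
neighbor of the witness as well; both are unlikely by Chernoff's bound. -/
lemma one_sub_exp_le_slack_of_le (hΨ : ∀ u, (Ψ u).card = G.maxDegree + 1) (v : V)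
    {C : Finset ℕ} {p : ℕ → V → ℝ} (hp : ∀ c x, (bitsLaw (Ψ x)).real {(true, c)} = p c x) {q : ℝ}
    (hpq : ∀ c x, p c x ≤ q) (hq : q * ((G.maxDegree : ℝ) + 1) ≤ 1 / 20) {μ : ℝ} (hμ0 : 0 ≤ μ)
    (hμ : ∑ c ∈ C, ∑ A ∈ slackWitnesses G Ψ v c, ∏ x ∈ A, p c x = μ) :
    1 - 2 * Real.exp (-μ / 20) ≤ (randomBits Ψ).real {ω | (G.maxDegree : ℝ) + 1 - G.degree v +
      μ / 4 ≤ (slack G Ψ (slackGeneration G ω) v : ℝ)} := by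
  classical
  have hne : ∀ x, (Ψ x).Nonempty := fun x => Finset.card_pos.1 (by rw [hΨ x]; omega)
  have hprob := fun x => isProbabilityMeasure_bitsLaw (hne x)
  have hprob' := isProbabilityMeasure_randomBits hne
  have hp0 : ∀ c x, 0 ≤ p c x := fun c x => hp c x ▸ measureReal_nonneg
  have hp1 : ∀ c x, p c x ≤ 1 := fun c x => hp c x ▸ measureReal_le_one
  have hhit := le_sum_bernoulliExp_witness (Ψ := Ψ) hp0 hp1 hpq hq v C
  have hspoil := sum_bernoulliExp_spoiled_witness_le (Ψ := Ψ) hp0 hp1 hpq hq v C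
  rw [hμ] at hhit hspoil
  have he : Function.Injective fun c : ℕ => (true, c) := fun a b h => (Prod.ext_iff.1 h).2
  have hlow := measureReal_mul_card_ge_le (fun x => bitsLaw (Ψ x)) he C
    (ContainsWitness G Ψ v)
    (fun c T T' hT ⟨A, hA, hAT⟩ => ⟨A, hA, hAT.trans hT⟩) (-1) (-(μ / 2))
  have hupp := measureReal_mul_card_ge_le (fun x => bitsLaw (Ψ x)) he C
    (ContainsSpoiledWitness G Ψ v)
    (fun c T T' hT ⟨A, hA, hAT, u, hu, x, hx, hux⟩ =>
      ⟨A, hA, hAT.trans hT, u, hu, x, hT hx, hux⟩) 1 (μ / 4)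
  simp only [hp] at hlow hupp
  have hexp1 : Real.exp (-1) ≤ 0.37 := by
    have := Real.exp_neg_one_lt_d9; linarith
  have hexp2 : Real.exp 1 ≤ 2.72 := by
    have := Real.exp_one_lt_d9; linarith
  have hexp3 : 1 ≤ Real.exp 1 := Real.one_le_exp zero_le_one
  -- the exponents are at most `-0.63 * 0.95 μ + μ / 2` and `1.72 * 0.1 μ - μ / 4`
  replace hlow := hlow.trans (b := _) (c := Real.exp (-μ / 20))
    (Real.exp_le_exp.2 (by nlinarith))
  replace hupp := hupp.trans (b := _) (c := Real.exp (-μ / 20))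
    (Real.exp_le_exp.2 (by nlinarith))
  change (randomBits Ψ).real _ ≤ _ at hlow
  change (randomBits Ψ).real _ ≤ _ at hupp
  have hcover := fun (good few many : Set (V → Bool × ℕ))
      (h : Set.univ ⊆ good ∪ (few ∪ many)) => calc
    (1 : ℝ) = (randomBits Ψ).real Set.univ := by simp
    _ ≤ (randomBits Ψ).real (good ∪ (few ∪ many)) := measureReal_mono h
    _ ≤ (randomBits Ψ).real good + (randomBits Ψ).real (few ∪ many) := measureReal_union_le _ _
    _ ≤ (randomBits Ψ).real good + ((randomBits Ψ).real few + (randomBits Ψ).real many) := by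
      gcongr; exact measureReal_union_le _ _
  refine sub_le_iff_le_add.2 ((hcover _ _ _ fun ω _ => ?_).trans
    ((add_le_add_right (add_le_add hlow hupp) _).trans (by rw [two_mul])))
  by_contra hcon
  simp only [Set.mem_union, not_or, Set.mem_ofPred_eq, not_le] at hcon
  obtain ⟨h1, h2, h3⟩ := hcon
  have h4 := card_add_le_slack_add_card (G := G) (Ψ := Ψ) ω v C
  rw [hΨ v] at h4
  have h5 := (Int.cast_le (R := ℝ)).2 h4
  push_cast at h5
  have h6 : -1 * ({c ∈ C | ContainsWitness G Ψ v c (triers ω c)}.card : ℝ) < -(μ / 2) := by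
    unfold triers; convert h2
  have h7 : 1 * ({c ∈ C | ContainsSpoiledWitness G Ψ v c (triers ω c)}.card : ℝ) < μ / 4 := by
    unfold triers; convert h3
  linarith

/-- With exponentially high probability the slack exceeds its initial value by a constant times
the number of nonadjacent pairs of neighbors over the degree. -/
lemma one_sub_exp_le_slack (hΨ : ∀ u, (Ψ u).card = G.maxDegree + 1) (v : V) :
    1 - 2 * Real.exp (-((nonadjPairs G v).card / (400 * ((G.maxDegree : ℝ) + 1))) / 20) ≤
      (randomBits Ψ).real {ω | (G.maxDegree : ℝ) + 1 - G.degree v +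
        ((nonadjPairs G v).card / (400 * ((G.maxDegree : ℝ) + 1))) / 4 ≤
          (slack G Ψ (slackGeneration G ω) v : ℝ)} := by
  classical
  have hprob' := isProbabilityMeasure_randomBits fun x =>
    Finset.card_pos.1 (by rw [hΨ x]; omega : 0 < (Ψ x).card)
  set q : ℝ := 1 / (20 * ((G.maxDegree : ℝ) + 1)) with hq
  have hq0 : 0 ≤ q := by positivity
  have hqΔ : q * ((G.maxDegree : ℝ) + 1) = 1 / 20 := by rw [hq]; field_simp
  have hd : (G.degree v : ℝ) ≤ G.maxDegree := Nat.cast_le.2 (G.degree_le_maxDegree v)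
  have hμ := le_sum_slackWitnesses (G := G) (v := v) (C := Finset.univ.biUnion Ψ)
      (fun x => Finset.subset_biUnion_of_mem Ψ (Finset.mem_univ x)) hΨ hq0 (by nlinarith)
  have hμ₀ : (nonadjPairs G v).card / (400 * ((G.maxDegree : ℝ) + 1)) =
      q ^ 2 * ((G.maxDegree + 1 : ℕ) * (nonadjPairs G v).card) := by
    rw [hq]
    push_cast
    field_simp
    norm_num
  rw [← hμ₀] at hμ
  have hμ₀0 : 0 ≤ (nonadjPairs G v).card / (400 * ((G.maxDegree : ℝ) + 1)) := by positivity
  have key := one_sub_exp_le_slack_of_le hΨ v (p := fun c x => if c ∈ Ψ x then q else 0)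
    (fun c x => by rw [bitsLaw_real_singleton, hΨ x, hq]; push_cast; rfl)
    (fun c x => by split_ifs <;> linarith) hqΔ.le (hμ₀0.trans hμ) rfl
  refine le_trans (by gcongr) (key.trans (measureReal_mono fun ω hω => ?_))
  simp only [Set.mem_ofPred_eq] at hω ⊢
  linarith

/-- The local sparsity is due to missing neighbors and to nonadjacent pairs of neighbors. -/
lemma maxDegree_mul_localSparsity_le (v : V) :
    (G.maxDegree : ℝ) * localSparsity G v ≤
      G.maxDegree * ((G.maxDegree : ℝ) - G.degree v) + (nonadjPairs G v).card := by
  rcases Nat.eq_zero_or_pos G.maxDegree with h0 | hpos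
  · simp [h0]
  have hΔ : (0 : ℝ) < G.maxDegree := Nat.cast_pos.2 hpos
  have h1 : (G.maxDegree : ℝ) * localSparsity G v =
      (G.maxDegree.choose 2 : ℝ) - inducedEdgeCount G (G.neighborSet v) := by
    unfold localSparsity
    field_simp
  have h2 : ((G.degree v).choose 2 : ℝ) ≤
      inducedEdgeCount G (G.neighborSet v) + (nonadjPairs G v).card := by
    exact_mod_cast choose_degree_le_inducedEdgeCount_add v
  have hd : (G.degree v : ℝ) ≤ G.maxDegree := Nat.cast_le.2 (G.degree_le_maxDegree v)
  rw [Nat.cast_choose_two] at h1 h2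
  nlinarith

end Main

end SlackGen

theorem mainTheorem4 :
    ∃ c₁ : ℝ, 0 < c₁ ∧ ∀ k : ℝ, 1 ≤ k → ∃ c : ℝ, 0 < c ∧
      ∀ (V : Type*) [Fintype V] (G : SimpleGraph V) [DecidableRel G.Adj]
        (Ψ : V → Finset ℕ), (∀ u, (Ψ u).card = G.maxDegree + 1) →
      ∀ v : V, c * Real.log (Fintype.card V) ≤ SlackGen.localSparsity G v →
        1 - (Fintype.card V : ℝ) ^ (-k) ≤
          (SlackGen.randomBits Ψ).real
            {ω | c₁ * SlackGen.localSparsity G v ≤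
              (SlackGen.slack G Ψ (SlackGen.slackGeneration G ω) v : ℝ)} := by
  refine ⟨1 / 6400, by norm_num, fun k hk => ⟨32000 * (k + 1), by linarith, ?_⟩⟩
  intro V _ G _ Ψ hΨ v hζ
  set ζ := SlackGen.localSparsity G v with hζdef
  have := SlackGen.isProbabilityMeasure_randomBits fun u =>
    Finset.card_pos.1 (by rw [hΨ u]; omega)
  have hn1 : 1 ≤ Fintype.card V := Fintype.card_pos_iff.2 ⟨v⟩
  have hlog : 0 ≤ Real.log (Fintype.card V) := Real.log_natCast_nonneg _
  have hζ0 : 0 ≤ ζ := le_trans (by positivity) hζ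
  have hn0 : (0 : ℝ) < Fintype.card V := Nat.cast_pos.2 hn1
  rcases hn1.eq_or_lt with hn | hn
  · rw [← hn]
    simp
  have hd : (G.degree v : ℝ) ≤ G.maxDegree := Nat.cast_le.2 (G.degree_le_maxDegree v)
  have hspars := SlackGen.maxDegree_mul_localSparsity_le (G := G) v
  rw [← hζdef] at hspars
  by_cases hcase : ζ / 2 ≤ (G.maxDegree : ℝ) + 1 - G.degree v
  · -- the slack is large from the start, and coloring vertices never lowers it
    have huniv : {ω | 1 / 6400 * ζ ≤
        (SlackGen.slack G Ψ (SlackGen.slackGeneration G ω) v : ℝ)} = Set.univ := by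
      refine Set.eq_univ_of_forall fun ω => ?_
      have h1 := SlackGen.card_sub_degree_add_card_le_slack (G := G) (Ψ := Ψ)
        (SlackGen.slackGeneration G ω) v ∅ (by simp)
      rw [hΨ v] at h1
      have h2 : ((G.maxDegree : ℝ) + 1 - G.degree v) ≤
          SlackGen.slack G Ψ (SlackGen.slackGeneration G ω) v := by
        simp only [Finset.card_empty] at h1
        push_cast at h1
        rw [add_zero] at h1
        exact_mod_cast h1
      simp only [Set.mem_ofPred_eq]
      linarith
    rw [huniv, probReal_univ]
    have := Real.rpow_nonneg hn0.le (-k)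
    linarith
  · push Not at hcase
    set μ₀ : ℝ := (SlackGen.nonadjPairs G v).card / (400 * ((G.maxDegree : ℝ) + 1)) with hμ₀
    have hΔ1 : (1 : ℝ) ≤ G.maxDegree := by
      rcases Nat.eq_zero_or_pos G.maxDegree with h0 | hpos
      · have : ζ = 0 := by simp [hζdef, SlackGen.localSparsity, h0]
        linarith
      · exact_mod_cast hpos
    have hμζ : ζ / 1600 ≤ μ₀ := by
      rw [hμ₀, div_le_div_iff₀ (by norm_num) (by positivity)]
      nlinarith
    have hprob := SlackGen.one_sub_exp_le_slack hΨ v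
    rw [← hμ₀] at hprob
    have hexp : 2 * Real.exp (-μ₀ / 20) ≤ (Fintype.card V : ℝ) ^ (-k) := by
      have h2 : (2 : ℝ) ≤ Fintype.card V := by exact_mod_cast hn
      calc 2 * Real.exp (-μ₀ / 20) ≤
            Fintype.card V * Real.exp (Real.log (Fintype.card V) * (-k - 1)) := by
            -- one factor `n` of the bound absorbs the constant `2`
            gcongr
            linarith
        _ = (Fintype.card V : ℝ) ^ (-k) := by
            rw [← Real.rpow_def_of_pos hn0, Real.rpow_sub hn0, Real.rpow_one]
            field_simp
    refine le_trans (by linarith) (hprob.trans (measureReal_mono fun ω hω => ?_))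
    simp only [Set.mem_ofPred_eq] at hω ⊢
    linarith
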